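/- Let $\alpha>\beta\ge 0$ be constants with $\sqrt{\alpha}-\sqrt{\beta}>\sqrt{2}$. Then there is a constant $c>0$, depending only on $\alpha$ and $\beta$, such that for all sufficiently large even $n$ the following holds. Let $p=\frac{\alpha\log n}{n}$ and $q=\frac{\beta\log n}{n}$ (both lie in $[0,1]$ for large $n$), and let $g\in\{\pm1\}^n$ with $\sum_{i=1}^n g_i=0$, so that $g$ encodes a partition of $\{1,\dots,n\}$ into two clusters of $n/2$ nodes each. Let $G$ be a random graph on $\{1,\dots,n\}$ drawn from the stochastic block model with these two clusters: each pair $i\ne j$ is an edge with probability $p$ if $g_i=g_j$ and with probability $q$ if $g_i\neq g_j$, independently of all other pairs. Let $A$ be the adjacency matrix of $G$, and consider the semidefinite program over symmetric matrices $X\in\mathbb{R}^{n\times n}$ \[ \max\ \operatorname{Tr}\left[\left(2A-(\mathbf 1\mathbf 1^T-I)\right)X\right]\quad\text{subject to}\quad X_{ii}=1\ (1\le i\le n),\quad X\succeq 0 . \] Then, with probability at least $1-n^{-c}$, the matrix $gg^T$ is the unique optimal solution of this semidefinite program; that is, the program exactly recovers the partition. -/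

import Mathlib

open MeasureTheory ProbabilityTheory Filter
open scoped unitInterval

namespace SBM

/-- `g ∈ {±1}^V` labels two clusters of equal size `|V| / 2`. -/
def IsBalancedLabeling {V : Type*} [Fintype V] (g : V → ℝ) : Prop :=
  (∀ i, g i = 1 ∨ g i = -1) ∧ ∑ i, g i = 0

open Classical in
/-- The probability that the pair `s(i, j)` is an edge: `p` if `i` and `j` are in the same cluster
of `g`, and `q` otherwise. -/
noncomputable def edgeProb {V : Type*} (g : V → ℝ) (p q : I) (e : Sym2 V) : I :=
  Sym2.lift ⟨fun i j => if g i = g j then p else q, fun i j => by simp only [eq_comm]⟩ e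

open Classical in
/-- The law of the stochastic block model on the vertex set `V` with clusters given by `g`:
the unordered pairs `e` are selected independently with probability `edgeProb g p q e`, and the
edges of the graph are the selected pairs of distinct vertices (`SimpleGraph.fromEdgeSet` drops
the pairs `s(i, i)`). -/
noncomputable def law {V : Type*} [Fintype V] (g : V → ℝ) (p q : I) : Measure (SimpleGraph V) :=
  (Measure.pi fun e : Sym2 V => bernoulliMeasure True False (edgeProb g p q e)).map
    fun s => SimpleGraph.fromEdgeSet {e | s e}

open Classical in
/-- The signed matrix `2 A - (𝟙 𝟙ᵀ - I)`, with `A` the adjacency matrix of `G`. -/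
noncomputable def signedAdj {V : Type*} [Fintype V] (G : SimpleGraph V) : Matrix V V ℝ :=
  (2 : ℝ) • G.adjMatrix ℝ - (Matrix.of (fun _ _ => (1 : ℝ)) - (1 : Matrix V V ℝ))

/-- The feasible set of the semidefinite program: `X ⪰ 0` (symmetric) with `X i i = 1`. -/
def sdpFeasible (V : Type*) : Set (Matrix V V ℝ) :=
  {X | (∀ i, X i i = 1) ∧ X.PosSemidef}

/-- The set of optimal solutions of the semidefinite program
`max Tr[(2 A - (𝟙 𝟙ᵀ - I)) X]` subject to `X i i = 1`, `X ⪰ 0`. -/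
def sdpSolutions {V : Type*} [Fintype V] (G : SimpleGraph V) : Set (Matrix V V ℝ) :=
  {X | X ∈ sdpFeasible V ∧ ∀ Y ∈ sdpFeasible V,
    (signedAdj G * Y).trace ≤ (signedAdj G * X).trace}

end SBM

/-!
A dual certificate reduces exact recovery to a comparison between degrees and a spectral norm. Let
`A` be the adjacency matrix and `d i = ∑ j, g i * g j * A i j` the number of neighbours of `i` in
its own cluster minus the number of those in the other one. For the objective matrix `B` the matrix
`diag (g i * (B g) i) - B` annihilates `g`; if it is positive definite on the orthogonal complement
of `g`, then `g gᵀ` is the only optimal solution (`sdpSolutions_eq_singleton`). There its quadratic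
form is at least `2 * (∑ i, d i * y i ^ 2 - yᵀ (A - E A) y)` (`certForm_signedAdj_ge`), so it
suffices that all `d i` are at least `ε * log n` while `A - E A` has its quadratic form below
`ε * log n`.

* The Chernoff bound gives `d i < ε * log n` probability at most `n ^ (-1 - c')`, precisely because
  `(√α - √β) ^ 2 / 2 > 1` (`exists_tilt`, `law_signedDegree_lt_le`).
* The true order of the spectral norm is `√(log n)`, and a bound by a small multiple of `log n` is
  enough. This leaves room for a simple form of the light and heavy pairs argument of Kahn and
  Szemerédi. On a net of at most `25 ^ n` vectors `z`, the pairs with `|z i * z j| ≤ δ * log n / n`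
  are handled by Bernstein's inequality and a union bound
  (`law_light_gt_le`). The other pairs are handled deterministically (`sum_heavy_le`): if the two
  entries are far from equal in size, the degree bound `O(log n)` suffices; if they are comparable,
  both endpoints lie in a set of `O(n / log n)` vertices. With high probability, every such set `S`
  spans at most `η * |S| * log n` edges, so the graph is degenerate on it, and its edges can be
  charged to their endpoints (`sum_mul_abs_le_of_sparse`).

All probabilistic estimates come from one exponential Markov inequality for linear functions of
the adjacency matrix (`law_real_le_exp`).
-/

namespace SBM

/-! ### Exponential tail bounds for the stochastic block model -/

instance discreteMeasurableSpace_simpleGraph {V : Type*} [Finite V] :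
    DiscreteMeasurableSpace (SimpleGraph V) where
  forall_measurableSet s := by
    have : Finite (Sym2 V) := Quot.finite _
    rw [← Set.preimage_image_eq s SimpleGraph.edgeSet_injective]
    exact SimpleGraph.measurable_edgeSet (Set.toFinite _).measurableSet

theorem measurable_fromEdgeSet_setOf {V : Type*} :
    Measurable fun s : Sym2 V → Prop => SimpleGraph.fromEdgeSet {e | s e} := by
  simp only [SimpleGraph.measurable_iff_adj, SimpleGraph.fromEdgeSet_adj]
  intro u v
  have : Measurable fun s : Sym2 V → Prop => s s(u, v) := measurable_pi_apply _
  exact this.and measurable_const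

instance isProbabilityMeasure_law {V : Type*} [Fintype V] (g : V → ℝ) (p q : I) :
    IsProbabilityMeasure (law g p q) := by
  unfold law
  exact Measure.isProbabilityMeasure_map measurable_fromEdgeSet_setOf.aemeasurable

open Classical in
theorem pi_bernoulli_real_le_exp {E : Type*} [Fintype E] (P : E → I) (w : E → ℝ) (t : ℝ) :
    (Measure.pi fun e => bernoulliMeasure True False (P e)).real
        {s | t ≤ ∑ e, if s e then w e else 0}
      ≤ Real.exp (-t + ∑ e, (P e : ℝ) * (Real.exp (w e) - 1)) := by
  have hmgf : mgf (fun s : E → Prop => ∑ e, if s e then w e else 0)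
      (Measure.pi fun e => bernoulliMeasure True False (P e)) 1
      = ∏ e, (1 + (P e : ℝ) * (Real.exp (w e) - 1)) := by
    simp only [mgf, one_mul, Real.exp_sum]
    rw [integral_fintype_prod_eq_prod (f := fun e (x : Prop) => Real.exp (if x then w e else 0))]
    refine Finset.prod_congr rfl fun e _ => ?_
    rw [integral_bernoulliMeasure]
    simp
    ring
  have h := measure_ge_le_exp_mul_mgf (μ := Measure.pi fun e => bernoulliMeasure True False (P e))
    (X := fun s : E → Prop => ∑ e, if s e then w e else 0) (t := 1) t zero_le_one
    Integrable.of_finite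
  refine h.trans ?_
  rw [hmgf, Real.exp_add, Real.exp_sum, neg_one_mul]
  refine mul_le_mul_of_nonneg_left ?_ (Real.exp_pos _).le
  refine Finset.prod_le_prod (fun e _ => ?_) (fun e _ => ?_)
  · nlinarith [(P e).2.1, (P e).2.2, Real.exp_pos (w e)]
  · rw [add_comm]; exact Real.add_one_le_exp _

open Classical in
/-- The mean of the adjacency matrix under `law g p q`. -/
noncomputable def meanAdj {V : Type*} (g : V → ℝ) (p q : I) : Matrix V V ℝ :=
  Matrix.of fun i j => if i = j then 0 else (edgeProb g p q s(i, j) : ℝ)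

theorem sum_fiber_sym2_of_ne {V : Type*} [Fintype V] [DecidableEq V] {a b : V} (hab : a ≠ b)
    (F : V × V → ℝ) :
    ∑ x with s(x.1, x.2) = s(a, b), F x = F (a, b) + F (b, a) := by
  have : (Finset.univ.filter fun x : V × V => s(x.1, x.2) = s(a, b)) = {(a, b), (b, a)} := by
    ext ⟨u, v⟩
    simp
  rw [this, Finset.sum_pair]
  simp [hab]

open Classical in
/-- Chernoff bound for a linear function of the adjacency matrix: an unordered pair `{i, j}`
contributes `2 * c i j` when it is an edge, and is counted twice in the sum over `i` and `j`. -/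
theorem law_real_le_exp {V : Type*} [Fintype V] (g : V → ℝ) (p q : I) (c : V → V → ℝ)
    (hc : ∀ i j, c i j = c j i) (t : ℝ) :
    (law g p q).real {G | t ≤ ∑ i, ∑ j, c i j * G.adjMatrix ℝ i j}
      ≤ Real.exp (-t + (∑ i, ∑ j, meanAdj g p q i j * (Real.exp (2 * c i j) - 1)) / 2) := by
  set w : Sym2 V → ℝ := fun e =>
    ∑ x : V × V with s(x.1, x.2) = e, if x.1 = x.2 then 0 else c x.1 x.2 with hw
  have hmean : ∑ i, ∑ j, meanAdj g p q i j * (Real.exp (2 * c i j) - 1)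
      = 2 * ∑ e, (edgeProb g p q e : ℝ) * (Real.exp (w e) - 1) := by
    rw [← Fintype.sum_prod_type' (f := fun i j => meanAdj g p q i j * (Real.exp (2 * c i j) - 1)),
      ← Finset.sum_fiberwise (s := Finset.univ) (g := fun x : V × V => s(x.1, x.2)),
      Finset.mul_sum]
    refine Finset.sum_congr rfl fun e _ => ?_
    induction e using Sym2.ind with | _ a b => ?_
    by_cases hab : a = b
    · subst hab
      have h0 : w s(a, a) = 0 := Finset.sum_eq_zero fun x hx => by
        simp at hx; grind
      rw [h0]
      simp only [Real.exp_zero, sub_self, mul_zero]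
      refine Finset.sum_eq_zero fun x hx => ?_
      have : x.1 = x.2 := by simp at hx; grind
      simp [meanAdj, this]
    · rw [sum_fiber_sym2_of_ne hab]
      have h0 : w s(a, b) = 2 * c a b := by
        rw [hw]
        simp only
        rw [sum_fiber_sym2_of_ne hab]
        simp [hab, Ne.symm hab, hc b a]
        ring
      rw [h0]
      simp only [meanAdj, Matrix.of_apply, hab, Ne.symm hab, if_false, hc b a,
        Sym2.eq_swap (a := b)]
      ring
  rw [hmean, mul_div_cancel_left₀ _ two_ne_zero, law, measureReal_def,
    Measure.map_apply measurable_fromEdgeSet_setOf (MeasurableSet.of_discrete), ← measureReal_def]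
  refine le_trans (le_of_eq ?_) (pi_bernoulli_real_le_exp (edgeProb g p q) w t)
  congr 1
  ext s
  have : ∀ G : SimpleGraph V, G = SimpleGraph.fromEdgeSet {e | s e} →
      ∑ i, ∑ j, c i j * G.adjMatrix ℝ i j = ∑ e, if s e then w e else 0 := by
    intro G hG
    have hadj : ∀ i j, G.Adj i j ↔ s s(i, j) ∧ i ≠ j := by simp [hG]
    rw [← Fintype.sum_prod_type' (f := fun i j => c i j * G.adjMatrix ℝ i j),
      ← Finset.sum_fiberwise (s := Finset.univ) (g := fun x : V × V => s(x.1, x.2))]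
    refine Finset.sum_congr rfl fun e _ => ?_
    rw [hw]
    split_ifs with h
    all_goals
    · first | refine Finset.sum_congr rfl fun x hx => ?_ | refine Finset.sum_eq_zero fun x hx => ?_
      have hx' : s(x.1, x.2) = e := by simpa using hx
      simp [SimpleGraph.adjMatrix_apply, hadj, hx', h]
  exact iff_of_eq (congrArg (t ≤ ·) (this _ rfl))

open Classical in
/-- Chernoff bound for a linear function of a single row of the adjacency matrix. -/
theorem law_row_real_le_exp {V : Type*} [Fintype V] (g : V → ℝ) (p q : I) (i : V) (v : V → ℝ)
    (t : ℝ) :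
    (law g p q).real {G | t ≤ ∑ j, v j * G.adjMatrix ℝ i j}
      ≤ Real.exp (-t + ∑ j, meanAdj g p q i j * (Real.exp (v j) - 1)) := by
  have h := law_real_le_exp g p q
    (fun k l => ((if k = i then v l else 0) + (if l = i then v k else 0)) / 2)
    (fun k l => by ring) t
  have hA : ∀ G : SimpleGraph V, ∑ k, ∑ l,
      ((if k = i then v l else 0) + (if l = i then v k else 0)) / 2 * G.adjMatrix ℝ k l
      = ∑ j, v j * G.adjMatrix ℝ i j := by
    intro G
    have h1 : ∀ k l, ((if k = i then v l else 0) + (if l = i then v k else 0)) / 2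
        * G.adjMatrix ℝ k l = (if k = i then v l * G.adjMatrix ℝ k l / 2 else 0)
          + (if l = i then v k * G.adjMatrix ℝ k l / 2 else 0) := by
      intro k l; split_ifs <;> ring
    simp only [h1, Finset.sum_add_distrib]
    rw [Finset.sum_comm]
    simp only [Finset.sum_ite_eq', Finset.mem_univ, if_true]
    rw [← Finset.sum_add_distrib]
    refine Finset.sum_congr rfl fun j _ => ?_
    simp only [SimpleGraph.adjMatrix_apply, G.adj_comm j i]
    ring
  have hP : ∑ k, ∑ l, meanAdj g p q k l *
      (Real.exp (2 * (((if k = i then v l else 0) + (if l = i then v k else 0)) / 2)) - 1)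
      = 2 * ∑ j, meanAdj g p q i j * (Real.exp (v j) - 1) := by
    have h1 : ∀ k l, meanAdj g p q k l *
      (Real.exp (2 * (((if k = i then v l else 0) + (if l = i then v k else 0)) / 2)) - 1)
      = (if k = i then meanAdj g p q k l * (Real.exp (v l) - 1) else 0)
        + (if l = i then meanAdj g p q k l * (Real.exp (v k) - 1) else 0) := by
      intro k l
      rw [mul_div_cancel₀ _ (two_ne_zero)]
      by_cases hk : k = i <;> by_cases hl : l = i <;> simp [hk, hl]
      simp [meanAdj]
    simp only [h1, Finset.sum_add_distrib]
    rw [Finset.sum_comm]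
    simp only [Finset.sum_ite_eq', Finset.mem_univ, if_true]
    rw [two_mul]
    congr 1
    refine Finset.sum_congr rfl fun j _ => ?_
    simp only [meanAdj, Matrix.of_apply, Sym2.eq_swap (a := j), eq_comm (a := j)]
  simp only [hA, hP] at h
  rwa [mul_div_cancel_left₀ _ two_ne_zero] at h

/-! ### The dual certificate of the semidefinite program -/

/-- The quadratic form of the dual certificate `diag (g i * (B g) i) - B` of the program with
objective matrix `B`. -/
def certForm {V : Type*} [Fintype V] (B : Matrix V V ℝ) (g y : V → ℝ) : ℝ :=
  ∑ i, ∑ j, B i j * (g i * g j * y i ^ 2 - y i * y j)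

/-- The certificate has `g` in its kernel. -/
theorem certForm_sub_smul {V : Type*} [Fintype V] {B : Matrix V V ℝ} (hB : B.IsSymm)
    {g : V → ℝ} (hg : ∀ i, g i = 1 ∨ g i = -1) (y : V → ℝ) (a : ℝ) :
    certForm B g (fun i => y i - a * g i) = certForm B g y := by
  have hsymm : ∀ y : V → ℝ, certForm B g y
      = ∑ i, ∑ j, B i j * (g i * g j * (y i ^ 2 + y j ^ 2) / 2 - y i * y j) := by
    intro y
    have h2 : certForm B g y = ∑ i, ∑ j, B i j * (g i * g j * y j ^ 2 - y i * y j) := by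
      rw [certForm, Finset.sum_comm]
      refine Finset.sum_congr rfl fun i _ => Finset.sum_congr rfl fun j _ => ?_
      rw [hB.apply i j]
      ring
    have h3 : certForm B g y = (certForm B g y
        + ∑ i, ∑ j, B i j * (g i * g j * y j ^ 2 - y i * y j)) / 2 := by rw [← h2]; ring
    rw [h3, certForm]
    simp only [← Finset.sum_add_distrib, Finset.sum_div]
    refine Finset.sum_congr rfl fun i _ => Finset.sum_congr rfl fun j _ => ?_
    ring
  rw [hsymm, hsymm]
  refine Finset.sum_congr rfl fun i _ => Finset.sum_congr rfl fun j _ => ?_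
  rcases hg i with h | h <;> rcases hg j with h' | h' <;> rw [h, h'] <;> ring

theorem signedAdj_apply {V : Type*} [Fintype V] [DecidableEq V] (G : SimpleGraph V)
    [DecidableRel G.Adj] (i j : V) :
    signedAdj G i j = 2 * G.adjMatrix ℝ i j - 1 + if i = j then 1 else 0 := by
  simp only [signedAdj, Matrix.sub_apply, Matrix.smul_apply, Matrix.of_apply, Matrix.one_apply,
    SimpleGraph.adjMatrix_apply, smul_eq_mul]
  split_ifs <;> ring

theorem signedAdj_isSymm {V : Type*} [Fintype V] (G : SimpleGraph V) : (signedAdj G).IsSymm := by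
  classical
  ext i j
  simp only [Matrix.transpose_apply, signedAdj_apply, SimpleGraph.adjMatrix_apply, G.adj_comm,
    eq_comm]

/-- If the dual certificate is positive definite on the orthogonal complement of `g`, then
`g gᵀ` is the unique optimal solution. -/
theorem sdpSolutions_eq_singleton {V : Type*} [Fintype V] (G : SimpleGraph V) {g : V → ℝ}
    (hg : ∀ i, g i = 1 ∨ g i = -1)
    (hpos : ∀ y : V → ℝ, ∑ i, g i * y i = 0 → y ≠ 0 → 0 < certForm (signedAdj G) g y) :
    sdpSolutions G = {Matrix.vecMulVec g g} := by
  classical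
  have hsymm := signedAdj_isSymm G
  set B := signedAdj G
  have hg2 : ∀ i, g i * g i = 1 := fun i => by rcases hg i with h | h <;> simp [h]
  -- Subtracting its projection to `g` from `y` does not change the value of the form.
  have hproj : ∀ y : V → ℝ, ∑ i, g i * (y i - (∑ j, g j * y j) / Fintype.card V * g i) = 0 := by
    intro y
    rcases isEmpty_or_nonempty V with h | h
    · simp
    · have : (Fintype.card V : ℝ) ≠ 0 := by simp
      have h1 : ∀ i, g i * (y i - (∑ j, g j * y j) / Fintype.card V * g i)
          = g i * y i - (∑ j, g j * y j) / Fintype.card V := fun i => by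
        linear_combination (-(∑ j, g j * y j) / Fintype.card V) * hg2 i
      simp only [h1, Finset.sum_sub_distrib, Finset.sum_const, Finset.card_univ, nsmul_eq_mul]
      rw [mul_div_cancel₀ _ this, sub_self]
  have hnonneg : ∀ y : V → ℝ, 0 ≤ certForm B g y := by
    intro y
    rw [← certForm_sub_smul hsymm hg y ((∑ j, g j * y j) / Fintype.card V)]
    by_cases h0 : (fun i => y i - (∑ j, g j * y j) / Fintype.card V * g i) = 0
    · rw [h0]; simp [certForm]
    · exact (hpos _ (hproj y) h0).le
  have hzero : ∀ y : V → ℝ, certForm B g y = 0 →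
      ∀ i, y i = (∑ j, g j * y j) / Fintype.card V * g i := by
    intro y hy i
    by_contra hne
    have h0 : (fun i => y i - (∑ j, g j * y j) / Fintype.card V * g i) ≠ 0 := fun h =>
      hne (sub_eq_zero.1 (congrFun h i))
    have := hpos _ (hproj y) h0
    rw [certForm_sub_smul hsymm hg, hy] at this
    exact this.false
  have hsum_apply : ∀ (m : ℕ) (C : Fin m → V → ℝ) (X : Matrix V V ℝ),
      X = ∑ k, Matrix.vecMulVec (C k) (star (C k)) → ∀ i j, X i j = ∑ k, C k i * C k j := by
    rintro m C X rfl i j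
    simp [Matrix.sum_apply, Matrix.vecMulVec_apply]
  have htrace : ∀ (m : ℕ) (C : Fin m → V → ℝ) (X : Matrix V V ℝ),
      X = ∑ k, Matrix.vecMulVec (C k) (star (C k)) → (∀ i, X i i = 1) →
      ∑ k, certForm B g (C k) = (B * Matrix.vecMulVec g g).trace - (B * X).trace := by
    intro m C X hX hdiag
    have hXij := hsum_apply m C X hX
    simp only [certForm, Matrix.trace, Matrix.diag, Matrix.mul_apply, Matrix.vecMulVec_apply,
      ← Finset.sum_sub_distrib]
    rw [Finset.sum_comm]
    refine Finset.sum_congr rfl fun i _ => ?_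
    rw [Finset.sum_comm]
    refine Finset.sum_congr rfl fun j _ => ?_
    rw [← Finset.mul_sum, Finset.sum_sub_distrib, ← Finset.mul_sum, ← mul_sub, hXij j i]
    have h1 : ∑ k, C k i ^ 2 = 1 := by rw [← hdiag i, hXij i i]; simp only [sq]
    rw [h1]
    simp only [mul_comm (C _ j)]
    ring
  have hgg : Matrix.vecMulVec g g ∈ sdpFeasible V := by
    refine ⟨fun i => by simp [Matrix.vecMulVec_apply, hg2], ?_⟩
    simpa using Matrix.posSemidef_vecMulVec_self_star (R := ℝ) g
  ext X
  simp only [Set.mem_singleton_iff]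
  constructor
  · rintro ⟨⟨hdiag, hX⟩, hopt⟩
    obtain ⟨m, C, hC⟩ := Matrix.posSemidef_iff_eq_sum_vecMulVec.1 hX
    have hsum := htrace m C X hC hdiag
    have hle : ∑ k, certForm B g (C k) ≤ 0 := by rw [hsum]; linarith [hopt _ hgg]
    have hall : ∀ k, certForm B g (C k) = 0 := fun k =>
      (Finset.sum_eq_zero_iff_of_nonneg fun k _ => hnonneg (C k)).1
        (le_antisymm hle (Finset.sum_nonneg fun k _ => hnonneg (C k))) k (Finset.mem_univ k)
    set a : Fin m → ℝ := fun k => (∑ j, g j * C k j) / Fintype.card V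
    have hCk : ∀ k i, C k i = a k * g i := fun k i => hzero _ (hall k) i
    have hXij : ∀ i j, X i j = (∑ k, a k ^ 2) * (g i * g j) := fun i j => by
      rw [hsum_apply m C X hC, Finset.sum_mul]
      simp only [hCk]
      exact Finset.sum_congr rfl fun k _ => by ring
    ext i j
    have h1 : ∑ k, a k ^ 2 = 1 := by rw [← hdiag i, hXij, hg2, mul_one]
    rw [hXij, h1, one_mul, Matrix.vecMulVec_apply]
  · rintro rfl
    refine ⟨hgg, fun Y hY => ?_⟩
    obtain ⟨m, C, hC⟩ := Matrix.posSemidef_iff_eq_sum_vecMulVec.1 hY.2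
    have := htrace m C Y hC hY.1
    linarith [Finset.sum_nonneg fun k (_ : k ∈ Finset.univ) => hnonneg (C k)]

open Classical in
theorem meanAdj_apply_eq {V : Type*} {g : V → ℝ}
    (hg : ∀ i, g i = 1 ∨ g i = -1) (p q : I) (i j : V) :
    meanAdj g p q i j
      = (p + q) / 2 + (p - q) / 2 * (g i * g j) - if i = j then (p : ℝ) else 0 := by
  simp only [meanAdj, Matrix.of_apply, edgeProb, Sym2.lift_mk]
  by_cases hij : i = j
  · subst hij
    rcases hg i with h | h <;> simp [h] <;> ring
  · rcases hg i with h | h <;> rcases hg j with h' | h' <;> simp [h, h', hij] <;>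
      norm_num <;> ring

open Classical in
/-- On the orthogonal complement of `g` the certificate is, up to a nonnegative term, twice the
diagonal matrix of the numbers `∑ j, g i * g j * A i j` minus twice the centred adjacency
matrix. -/
theorem certForm_signedAdj_ge {V : Type*} [Fintype V] (G : SimpleGraph V) {g : V → ℝ}
    (hg : IsBalancedLabeling g) {p q : I} (hpq : (p : ℝ) + q ≤ 1) {y : V → ℝ}
    (hy : ∑ i, g i * y i = 0) :
    2 * (∑ i, (∑ j, g i * g j * G.adjMatrix ℝ i j) * y i ^ 2
      - ∑ i, ∑ j, (G.adjMatrix ℝ i j - meanAdj g p q i j) * (y i * y j))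
      ≤ certForm (signedAdj G) g y := by
  obtain ⟨hg1, hg0⟩ := hg
  have hg2 : ∀ i, g i * g i = 1 := fun i => by rcases hg1 i with h | h <;> simp [h]
  have hsq : ∀ x : V → ℝ, ∑ i, ∑ j, x i * x j = (∑ i, x i) ^ 2 := fun x => by
    rw [sq, Finset.sum_mul_sum]
  have h1 : certForm (signedAdj G) g y
      = 2 * ∑ i, (∑ j, g i * g j * G.adjMatrix ℝ i j) * y i ^ 2
        - 2 * ∑ i, ∑ j, G.adjMatrix ℝ i j * (y i * y j) + (∑ i, y i) ^ 2 := by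
    have h : ∀ i, ∑ j, signedAdj G i j * (g i * g j * y i ^ 2 - y i * y j)
        = 2 * ((∑ j, g i * g j * G.adjMatrix ℝ i j) * y i ^ 2)
          - 2 * ∑ j, G.adjMatrix ℝ i j * (y i * y j) + ∑ j, y i * y j := by
      intro i
      have h' : ∀ j, signedAdj G i j * (g i * g j * y i ^ 2 - y i * y j)
          = 2 * (g i * g j * G.adjMatrix ℝ i j * y i ^ 2)
            - 2 * (G.adjMatrix ℝ i j * (y i * y j)) + y i * y j - g i * y i ^ 2 * g j
            + if i = j then g i * g j * y i ^ 2 - y i * y j else 0 := by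
        intro j
        rw [signedAdj_apply]
        split_ifs <;> ring
      simp only [h', Finset.sum_add_distrib, Finset.sum_sub_distrib, ← Finset.mul_sum,
        ← Finset.sum_mul, Finset.sum_ite_eq, Finset.mem_univ, if_true, hg0, hg2]
      ring
    rw [certForm]
    simp only [h, Finset.sum_add_distrib, Finset.sum_sub_distrib, hsq]
    rw [← Finset.mul_sum, ← Finset.mul_sum]
  have h2 : ∑ i, ∑ j, meanAdj g p q i j * (y i * y j)
      = (p + q) / 2 * (∑ i, y i) ^ 2 - p * ∑ i, y i ^ 2 := by
    have h' : ∀ i j, meanAdj g p q i j * (y i * y j)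
        = (p + q) / 2 * (y i * y j) + (p - q) / 2 * ((g i * y i) * (g j * y j))
          - if i = j then p * (y i * y j) else 0 := by
      intro i j
      rw [meanAdj_apply_eq hg1]
      split_ifs <;> ring
    have hsq' : ∀ (a : ℝ) (x : V → ℝ), ∑ i, ∑ j, a * (x i * x j) = a * (∑ i, x i) ^ 2 := by
      intro a x
      rw [← hsq]
      simp only [Finset.mul_sum]
    simp only [h', Finset.sum_add_distrib, Finset.sum_sub_distrib, Finset.sum_ite_eq,
      Finset.mem_univ, if_true]
    rw [hsq' _ y, hsq' _ fun i => g i * y i, hy, Finset.mul_sum]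
    simp only [sq]
    ring
  simp only [sub_mul, Finset.sum_sub_distrib, h1, h2]
  have h3 : 0 ≤ ∑ i, y i ^ 2 := Finset.sum_nonneg fun i _ => sq_nonneg _
  nlinarith [p.2.1, mul_nonneg p.2.1 h3, mul_nonneg (sub_nonneg.2 hpq) (sq_nonneg (∑ i, y i))]

/-! ### Quadratic forms on a net of the unit ball -/

/-- In dimension `d` the balls of radius `1` around some `5 ^ d` points cover the ball of
radius `2`. -/
theorem exists_finset_cover_closedBall_two (E : Type*) [NormedAddCommGroup E] [NormedSpace ℝ E]
    [FiniteDimensional ℝ E] :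
    ∃ N : Finset E, N.card ≤ 5 ^ Module.finrank ℝ E ∧ (∀ z ∈ N, ‖z‖ ≤ 2) ∧
      ∀ y : E, ‖y‖ ≤ 2 → ∃ z ∈ N, ‖y - z‖ ≤ 1 := by
  classical
  -- A 1-separated set of the largest possible size is a covering.
  let Sep : Finset E → Prop := fun N =>
    (∀ z ∈ N, ‖z‖ ≤ 2) ∧ ∀ c ∈ N, ∀ d ∈ N, c ≠ d → 1 ≤ ‖c - d‖
  have hcard : ∀ N, Sep N → N.card ≤ 5 ^ Module.finrank ℝ E := fun N hN =>
    Besicovitch.card_le_of_separated N hN.1 hN.2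
  let Q : ℕ → Prop := fun k => ∃ N, Sep N ∧ N.card = k
  have hQ0 : Q 0 := ⟨∅, ⟨by simp, by simp⟩, rfl⟩
  obtain ⟨N, hN, hNk⟩ : Q (Nat.findGreatest Q (5 ^ Module.finrank ℝ E)) :=
    Nat.findGreatest_spec (Nat.zero_le _) hQ0
  refine ⟨N, hcard N hN, hN.1, fun y hy => ?_⟩
  by_contra! hcon
  have hyN : y ∉ N := fun h => by
    have := hcon y h
    simp at this
    linarith
  have hins : Sep (insert y N) := by
    refine ⟨fun z hz => ?_, fun c hc d hd hcd => ?_⟩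
    · rcases Finset.mem_insert.1 hz with rfl | hz
      · exact hy
      · exact hN.1 z hz
    · rcases Finset.mem_insert.1 hc with hc | hc <;> rcases Finset.mem_insert.1 hd with hd | hd
      · exact absurd (hc.trans hd.symm) hcd
      · rw [hc]; exact (hcon d hd).le
      · rw [hd, norm_sub_rev]; exact (hcon c hc).le
      · exact hN.2 c hc d hd hcd
  have h1 := Nat.le_findGreatest (hcard _ hins) (show Q _ from ⟨_, hins, rfl⟩)
  rw [Finset.card_insert_of_notMem hyN, hNk] at h1
  omega

/-- A `1/4`-net of the Euclidean unit ball, obtained by covering at scale `1/2` and covering each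
of the balls found at scale `1/4`. -/
theorem exists_net (V : Type*) [Fintype V] :
    ∃ N : Finset (V → ℝ), N.card ≤ 25 ^ Fintype.card V ∧ (∀ z ∈ N, ∑ i, z i ^ 2 ≤ 9 / 4) ∧
      ∀ y : V → ℝ, ∑ i, y i ^ 2 ≤ 1 → ∃ z ∈ N, ∑ i, (y i - z i) ^ 2 ≤ 1 / 16 := by
  classical
  obtain ⟨N, hcard, hN2, hN⟩ := exists_finset_cover_closedBall_two (EuclideanSpace ℝ V)
  have hnorm : ∀ y : EuclideanSpace ℝ V, ∑ i, y i ^ 2 = ‖y‖ ^ 2 := fun y =>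
    (EuclideanSpace.real_norm_sq_eq y).symm
  refine ⟨(N ×ˢ N).image fun x => WithLp.ofLp ((1 / 2 : ℝ) • x.1 + (1 / 4 : ℝ) • x.2),
    ?_, ?_, ?_⟩
  · refine Finset.card_image_le.trans ?_
    rw [finrank_euclideanSpace] at hcard
    rw [Finset.card_product, show 25 = 5 * 5 by norm_num, mul_pow]
    exact Nat.mul_le_mul hcard hcard
  · intro z hz
    obtain ⟨⟨a, b⟩, hab, rfl⟩ := Finset.mem_image.1 hz
    rw [Finset.mem_product] at hab
    rw [hnorm]
    have h := norm_add_le ((1 / 2 : ℝ) • a) ((1 / 4 : ℝ) • b)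
    rw [norm_smul, norm_smul] at h
    norm_num at h
    have := hN2 a hab.1
    have := hN2 b hab.2
    have h3 : ‖(1 / 2 : ℝ) • a + (1 / 4 : ℝ) • b‖ ≤ 3 / 2 := by norm_num; linarith
    calc _ ≤ (3 / 2 : ℝ) ^ 2 := pow_le_pow_left₀ (norm_nonneg _) h3 2
      _ = 9 / 4 := by norm_num
  · intro y hy
    have hy1 : ‖WithLp.toLp 2 y‖ ≤ 1 := by
      rw [← sq_le_one_iff₀ (norm_nonneg _), ← hnorm]; exact hy
    obtain ⟨a, ha, hya⟩ := hN ((2 : ℝ) • WithLp.toLp 2 y) (by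
      rw [norm_smul]; norm_num; linarith)
    obtain ⟨b, hb, hyb⟩ := hN ((2 : ℝ) • ((2 : ℝ) • WithLp.toLp 2 y - a)) (by
      rw [norm_smul]; norm_num; linarith)
    refine ⟨_, Finset.mem_image.2 ⟨(a, b), Finset.mem_product.2 ⟨ha, hb⟩, rfl⟩, ?_⟩
    have h4 : WithLp.toLp 2 y - ((1 / 2 : ℝ) • a + (1 / 4 : ℝ) • b)
        = (1 / 4 : ℝ) • ((2 : ℝ) • ((2 : ℝ) • WithLp.toLp 2 y - a) - b) := by module
    have h5 : ‖WithLp.toLp 2 y - ((1 / 2 : ℝ) • a + (1 / 4 : ℝ) • b)‖ ≤ 1 / 4 := by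
      rw [h4, norm_smul]; norm_num; linarith
    calc _ = ‖WithLp.toLp 2 y - ((1 / 2 : ℝ) • a + (1 / 4 : ℝ) • b)‖ ^ 2 := by
          rw [← hnorm]; rfl
      _ ≤ (1 / 4 : ℝ) ^ 2 := pow_le_pow_left₀ (norm_nonneg _) h5 2
      _ = 1 / 16 := by norm_num

/-- A bound for a quadratic form on a `1/4`-net extends to the whole space. -/
theorem abs_quadForm_le_of_net {V : Type*} [Fintype V] (M : V → V → ℝ) {N : Finset (V → ℝ)}
    (hN : ∀ y : V → ℝ, ∑ i, y i ^ 2 ≤ 1 → ∃ z ∈ N, ∑ i, (y i - z i) ^ 2 ≤ 1 / 16) {T : ℝ}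
    (hT : ∀ z ∈ N, |∑ i, ∑ j, M i j * (z i * z j)| ≤ T) (y : V → ℝ) :
    |∑ i, ∑ j, M i j * (y i * y j)| ≤ 4 * T * ∑ i, y i ^ 2 := by
  set Q : (V → ℝ) → ℝ := fun y => ∑ i, ∑ j, M i j * (y i * y j) with hQ
  have hcont : Continuous fun y => |Q y| := by fun_prop
  have hcomp : IsCompact {y : V → ℝ | ∑ i, y i ^ 2 ≤ 1} := by
    refine (isCompact_Icc (a := fun _ : V => (-1 : ℝ)) (b := fun _ => 1)).of_isClosed_subset
      (isClosed_le (by fun_prop) (by fun_prop)) fun y hy => ?_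
    have h : ∀ i, |y i| ≤ 1 := fun i => by
      rw [← sq_le_one_iff_abs_le_one]
      exact (Finset.single_le_sum (f := fun i => y i ^ 2) (fun i _ => sq_nonneg _)
        (Finset.mem_univ i)).trans hy
    exact ⟨fun i => (abs_le.1 (h i)).1, fun i => (abs_le.1 (h i)).2⟩
  obtain ⟨x, hx, hmax⟩ := hcomp.exists_isMaxOn ⟨0, by simp⟩ hcont.continuousOn
  have hx1 : ∑ i, x i ^ 2 ≤ 1 := hx
  -- By homogeneity the maximum on the unit ball bounds the form everywhere.
  have hhom : ∀ (a : ℝ) (y : V → ℝ), Q (fun i => a * y i) = a ^ 2 * Q y := by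
    intro a y
    simp only [hQ, Finset.mul_sum]
    exact Finset.sum_congr rfl fun i _ => Finset.sum_congr rfl fun j _ => by ring
  have hle : ∀ y, |Q y| ≤ |Q x| * ∑ i, y i ^ 2 := by
    intro y
    rcases (Finset.sum_nonneg fun i _ => sq_nonneg (y i) : 0 ≤ ∑ i, y i ^ 2).eq_or_lt with h0 | h0
    · have hy : y = 0 := by
        ext i
        have := (Finset.sum_eq_zero_iff_of_nonneg fun i _ => sq_nonneg (y i)).1 h0.symm i
          (Finset.mem_univ i)
        simpa using this
      simp [hy, hQ]
    · set r := ∑ i, y i ^ 2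
      have h1 : (fun i => (Real.sqrt r)⁻¹ * y i) ∈ {y : V → ℝ | ∑ i, y i ^ 2 ≤ 1} := by
        show ∑ i, ((Real.sqrt r)⁻¹ * y i) ^ 2 ≤ 1
        simp only [mul_pow, ← Finset.mul_sum, inv_pow, Real.sq_sqrt h0.le]
        exact (inv_mul_cancel₀ h0.ne').le
      have h2 : |Q fun i => (Real.sqrt r)⁻¹ * y i| ≤ |Q x| := hmax h1
      rw [hhom, inv_pow, Real.sq_sqrt h0.le, abs_mul, abs_inv, abs_of_pos h0,
        inv_mul_le_iff₀ h0] at h2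
      linarith
  obtain ⟨z, hz, hxz⟩ := hN x hx1
  have hzT := hT z hz
  set r : V → ℝ := fun i => x i - z i
  set b := ∑ i, ∑ j, M i j * (x i * r j + r i * x j) with hb
  have hexp : ∀ s : ℝ, Q (fun i => x i + s * r i) = Q x + s * b + s ^ 2 * Q r := by
    intro s
    simp only [hQ, hb, Finset.mul_sum, ← Finset.sum_add_distrib]
    exact Finset.sum_congr rfl fun i _ => Finset.sum_congr rfl fun j _ => by ring
  have hz_eq : Q z = Q x - b + Q r := by
    have h := hexp (-1)
    have : (fun i => x i + (-1) * r i) = z := by ext i; simp [r]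
    rw [this] at h
    rw [h]; ring
  have hpar : ∑ i, (x i + 4 * r i) ^ 2 + ∑ i, (x i + (-4) * r i) ^ 2
      = 2 * ∑ i, x i ^ 2 + 32 * ∑ i, r i ^ 2 := by
    simp only [Finset.mul_sum, ← Finset.sum_add_distrib]
    exact Finset.sum_congr rfl fun i _ => by ring
  have hp := hle fun i => x i + 4 * r i
  have hm := hle fun i => x i + (-4) * r i
  have hr := hle r
  rw [hexp] at hp hm
  have hQx : 0 ≤ |Q x| := abs_nonneg _
  have hb8 : |8 * b| ≤ |Q x| * 4 := by
    have h1 : 8 * b = (Q x + 4 * b + 4 ^ 2 * Q r) - (Q x + -4 * b + (-4) ^ 2 * Q r) := by ring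
    rw [h1]
    refine (abs_sub _ _).trans ((add_le_add hp hm).trans ?_)
    rw [← mul_add, hpar]
    exact mul_le_mul_of_nonneg_left (by linarith) hQx
  have hr16 : |Q r| ≤ |Q x| * (1 / 16) := hr.trans (mul_le_mul_of_nonneg_left hxz hQx)
  have hxT : |Q x| ≤ 4 * T := by
    have h1 : Q x = Q z + b - Q r := by rw [hz_eq]; ring
    have h2 : |Q x| ≤ |Q z| + |b| + |Q r| := by
      calc |Q x| = |Q z + b - Q r| := by rw [← h1]
        _ ≤ |Q z + b| + |Q r| := abs_sub _ _
        _ ≤ _ := by linarith [abs_add_le (Q z) b]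
    rw [abs_mul, abs_of_pos (by norm_num : (0 : ℝ) < 8)] at hb8
    have h3 : |Q z| ≤ T := hzT
    linarith
  exact (hle y).trans (mul_le_mul_of_nonneg_right hxT (Finset.sum_nonneg fun i _ => sq_nonneg _))

/-! ### Heavy pairs -/

/-- If every subset of `S` spans few edges, the weighted graph `A` is degenerate on `S`, and its
edges can be charged to their endpoints in such a way that each vertex pays for total weight at
most `d`. -/
theorem sum_mul_abs_le_of_sparse {V : Type*} [DecidableEq V] {A : V → V → ℝ}
    (hA : ∀ i j, 0 ≤ A i j) (hsymm : ∀ i j, A i j = A j i) (hdiag : ∀ i, A i i = 0)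
    {d t : ℝ} (ht : 0 < t) (y : V → ℝ) (S : Finset V)
    (hS : ∀ T ⊆ S, ∑ i ∈ T, ∑ j ∈ T, A i j ≤ d * T.card) :
    ∑ i ∈ S, ∑ j ∈ S, A i j * (|y i| * |y j|)
      ≤ d * t * ∑ i ∈ S, y i ^ 2 + (∑ i ∈ S, ∑ j ∈ S, A i j * y j ^ 2) / t := by
  induction S using Finset.strongInduction with | H S ih => ?_
  rcases S.eq_empty_or_nonempty with rfl | hne
  · simp
  -- A vertex of at most average degree is removed first.
  obtain ⟨v, hv, hvd⟩ : ∃ v ∈ S, ∑ j ∈ S, A v j ≤ d := by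
    refine Finset.exists_le_of_sum_le hne ?_
    rw [Finset.sum_const, nsmul_eq_mul, mul_comm]
    exact hS S subset_rfl
  obtain ⟨T, hvT, rfl⟩ : ∃ T, v ∉ T ∧ insert v T = S :=
    ⟨S.erase v, Finset.notMem_erase _ _, Finset.insert_erase hv⟩
  have hT := ih T (Finset.ssubset_insert hvT) fun U hU =>
    hS U (hU.trans (Finset.subset_insert _ _))
  simp only [Finset.sum_insert hvT, hdiag, zero_mul, zero_add, Finset.sum_add_distrib] at hvd ⊢
  have hsw : ∑ i ∈ T, A i v * (|y i| * |y v|) = ∑ j ∈ T, A v j * (|y v| * |y j|) :=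
    Finset.sum_congr rfl fun i _ => by rw [hsymm i v]; ring
  have hedge : ∑ j ∈ T, A v j * (|y v| * |y j|) + ∑ j ∈ T, A v j * (|y v| * |y j|)
      ≤ d * t * y v ^ 2 + (∑ j ∈ T, A v j * y j ^ 2) / t := by
    have h1 : ∀ j ∈ T, A v j * (|y v| * |y j|) + A v j * (|y v| * |y j|)
        ≤ A v j * (t * y v ^ 2) + A v j * y j ^ 2 / t := by
      intro j _
      have h2 : |y v| * |y j| + |y v| * |y j| ≤ t * y v ^ 2 + y j ^ 2 / t := by
        have h3 : t * y v ^ 2 + y j ^ 2 / t - (|y v| * |y j| + |y v| * |y j|)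
            = (t * |y v| - |y j|) ^ 2 / t := by
          rw [← sq_abs (y v), ← sq_abs (y j)]
          field_simp
          ring
        have : 0 ≤ (t * |y v| - |y j|) ^ 2 / t := by positivity
        linarith
      calc _ = A v j * (|y v| * |y j| + |y v| * |y j|) := by ring
        _ ≤ A v j * (t * y v ^ 2 + y j ^ 2 / t) := mul_le_mul_of_nonneg_left h2 (hA v j)
        _ = _ := by ring
    have h4 := Finset.sum_le_sum h1
    rw [Finset.sum_add_distrib, Finset.sum_add_distrib, ← Finset.sum_mul, ← Finset.sum_div] at h4
    have h5 : (∑ j ∈ T, A v j) * (t * y v ^ 2) ≤ d * (t * y v ^ 2) :=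
      mul_le_mul_of_nonneg_right hvd (by positivity)
    linarith
  have hrest : 0 ≤ (∑ i ∈ T, A i v * y v ^ 2) / t :=
    div_nonneg (Finset.sum_nonneg fun i _ => mul_nonneg (hA _ _) (sq_nonneg _)) ht.le
  rw [hsw, add_div, add_div, mul_add]
  linarith

/-- The contribution of the heavy pairs, those with `τ < |y i * y j|`. Pairs whose two entries
differ by a factor of more than `K` are controlled by the degrees; the remaining ones join vertices
with `τ ≤ K * y i ^ 2`, which form a small and hence sparse set. -/
theorem sum_heavy_le {V : Type*} [Fintype V] {A : V → V → ℝ}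
    (hA : ∀ i j, 0 ≤ A i j) (hsymm : ∀ i j, A i j = A j i) (hdiag : ∀ i, A i i = 0)
    {Δ d τ K R : ℝ} (hK : 0 < K) (hτ : 0 < τ) (hd : 0 ≤ d) (hΔ : 0 ≤ Δ)
    (hdeg : ∀ i, ∑ j, A i j ≤ Δ)
    (hsparse : ∀ T : Finset V, (T.card : ℝ) ≤ K * R / τ → ∑ i ∈ T, ∑ j ∈ T, A i j ≤ d * T.card)
    {y : V → ℝ} (hy : ∑ i, y i ^ 2 ≤ R) :
    ∑ i, ∑ j, (if |y i * y j| ≤ τ then 0 else A i j * |y i * y j|)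
      ≤ (3 * Δ / K + d * K) * R := by
  classical
  have hR : 0 ≤ R := (Finset.sum_nonneg fun i _ => sq_nonneg _).trans hy
  set S : Finset V := Finset.univ.filter fun i => τ ≤ K * y i ^ 2 with hS
  have hcard : (S.card : ℝ) ≤ K * R / τ := by
    rw [le_div_iff₀ hτ, ← nsmul_eq_mul]
    calc S.card • τ ≤ ∑ i ∈ S, K * y i ^ 2 :=
          Finset.card_nsmul_le_sum _ _ _ fun i hi => (Finset.mem_filter.1 hi).2
      _ ≤ ∑ i, K * y i ^ 2 := Finset.sum_le_sum_of_subset_of_nonneg (Finset.subset_univ _)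
          fun i _ _ => by positivity
      _ ≤ K * R := by rw [← Finset.mul_sum]; exact mul_le_mul_of_nonneg_left hy hK.le
  have hsq : ∑ i, ∑ j, A i j * y j ^ 2 ≤ Δ * R := by
    rw [Finset.sum_comm]
    calc _ ≤ ∑ j, Δ * y j ^ 2 := Finset.sum_le_sum fun j _ => by
            rw [← Finset.sum_mul]
            refine mul_le_mul_of_nonneg_right ?_ (sq_nonneg _)
            simpa only [hsymm _ j] using hdeg j
      _ ≤ Δ * R := by
        rw [← Finset.mul_sum]
        exact mul_le_mul_of_nonneg_left hy hΔ
  have hsq' : ∑ i, ∑ j, A i j * y i ^ 2 ≤ Δ * R := by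
    rw [Finset.sum_comm]
    simpa only [hsymm] using hsq
  have hdegen := sum_mul_abs_le_of_sparse hA hsymm hdiag hK y S fun T hT =>
    hsparse T (le_trans (by exact_mod_cast Finset.card_le_card hT) hcard)
  have hSy : ∑ i ∈ S, y i ^ 2 ≤ R :=
    (Finset.sum_le_sum_of_subset_of_nonneg (Finset.subset_univ _) fun i _ _ => sq_nonneg _).trans hy
  have hSsq : ∑ i ∈ S, ∑ j ∈ S, A i j * y j ^ 2 ≤ Δ * R := by
    refine le_trans ?_ hsq
    refine (Finset.sum_le_sum fun i _ => Finset.sum_le_sum_of_subset_of_nonneg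
      (Finset.subset_univ _) fun j _ _ => mul_nonneg (hA i j) (sq_nonneg _)).trans ?_
    exact Finset.sum_le_sum_of_subset_of_nonneg (Finset.subset_univ _) fun i _ _ =>
      Finset.sum_nonneg fun j _ => mul_nonneg (hA i j) (sq_nonneg _)
  have hunbal : ∀ a b : ℝ, 0 ≤ a → 0 ≤ b → K * a ^ 2 < τ → τ < a * b → a * b ≤ b ^ 2 / K := by
    intro a b ha hb h1 h2
    have hKab : K * a ≤ b := by
      by_contra! h
      nlinarith [mul_le_mul_of_nonneg_left h.le ha]
    rw [le_div_iff₀ hK]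
    nlinarith [mul_le_mul_of_nonneg_right hKab hb]
  have hpt : ∀ i j, (if |y i * y j| ≤ τ then 0 else A i j * |y i * y j|)
      ≤ A i j * y i ^ 2 / K + A i j * y j ^ 2 / K
        + if i ∈ S then (if j ∈ S then A i j * (|y i| * |y j|) else 0) else 0 := by
    intro i j
    have hi2 : 0 ≤ A i j * y i ^ 2 / K := div_nonneg (mul_nonneg (hA i j) (sq_nonneg _)) hK.le
    have hj2 : 0 ≤ A i j * y j ^ 2 / K := div_nonneg (mul_nonneg (hA i j) (sq_nonneg _)) hK.le
    have hS0 : 0 ≤ if i ∈ S then (if j ∈ S then A i j * (|y i| * |y j|) else 0) else 0 := by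
      split_ifs <;> first | exact le_rfl | exact mul_nonneg (hA i j) (by positivity)
    by_cases hl : |y i * y j| ≤ τ
    · rw [if_pos hl]
      linarith
    rw [if_neg hl]
    rw [abs_mul, not_le] at hl
    rw [abs_mul]
    by_cases hi : i ∈ S
    · by_cases hj : j ∈ S
      · rw [if_pos hi, if_pos hj]
        linarith
      · have h1 : K * |y j| ^ 2 < τ := by simpa [hS] using hj
        have h2 := hunbal _ _ (abs_nonneg _) (abs_nonneg _) h1 (by rwa [mul_comm])
        rw [sq_abs, mul_comm] at h2
        have h3 := mul_le_mul_of_nonneg_left h2 (hA i j)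
        rw [mul_div_assoc'] at h3
        linarith
    · have h1 : K * |y i| ^ 2 < τ := by simpa [hS] using hi
      have h2 := hunbal _ _ (abs_nonneg _) (abs_nonneg _) h1 hl
      rw [sq_abs] at h2
      have h3 := mul_le_mul_of_nonneg_left h2 (hA i j)
      rw [mul_div_assoc'] at h3
      linarith
  calc _ ≤ _ := Finset.sum_le_sum fun i _ => Finset.sum_le_sum fun j _ => hpt i j
    _ = (∑ i, ∑ j, A i j * y i ^ 2) / K + (∑ i, ∑ j, A i j * y j ^ 2) / K
        + ∑ i ∈ S, ∑ j ∈ S, A i j * (|y i| * |y j|) := by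
      simp only [Finset.sum_add_distrib, Finset.sum_div]
      congr 1
      have h : ∀ i, (∑ j, if i ∈ S then (if j ∈ S then A i j * (|y i| * |y j|) else 0) else 0)
          = if i ∈ S then ∑ j ∈ S, A i j * (|y i| * |y j|) else 0 := by
        intro i
        split_ifs
        · rw [Finset.sum_ite_mem, Finset.univ_inter]
        · exact Finset.sum_const_zero
      simp only [h, Finset.sum_ite_mem, Finset.univ_inter]
    _ ≤ Δ * R / K + Δ * R / K + (d * K * R + Δ * R / K) := by
      have h1 : d * K * ∑ i ∈ S, y i ^ 2 ≤ d * K * R :=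
        mul_le_mul_of_nonneg_left hSy (by positivity)
      have h2 := div_le_div_of_nonneg_right hsq hK.le
      have h3 := div_le_div_of_nonneg_right hsq' hK.le
      have h4 := div_le_div_of_nonneg_right hSsq hK.le
      linarith
    _ = _ := by ring

/-- Spectral bound for the difference of a sparse matrix `A` and a matrix `P` with small entries:
on a net, the light pairs are assumed to be under control, and the heavy pairs are small
because `A` has bounded degrees and is sparse on small sets. -/
theorem quadForm_sub_le {V : Type*} [Fintype V] {A P : V → V → ℝ}
    (hA : ∀ i j, 0 ≤ A i j) (hsymm : ∀ i j, A i j = A j i) (hdiag : ∀ i, A i i = 0)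
    {Δ d τ K ρ T : ℝ} (hK : 0 < K) (hτ : 0 < τ) (hd : 0 ≤ d) (hΔ : 0 ≤ Δ) (hρ : 0 ≤ ρ)
    (hP : ∀ i j, |P i j| ≤ ρ)
    (hdeg : ∀ i, ∑ j, A i j ≤ Δ)
    (hsparse : ∀ T : Finset V, (T.card : ℝ) ≤ K * (9 / 4) / τ →
      ∑ i ∈ T, ∑ j ∈ T, A i j ≤ d * T.card)
    {N : Finset (V → ℝ)}
    (hN : ∀ y : V → ℝ, ∑ i, y i ^ 2 ≤ 1 → ∃ z ∈ N, ∑ i, (y i - z i) ^ 2 ≤ 1 / 16)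
    (hN2 : ∀ z ∈ N, ∑ i, z i ^ 2 ≤ 9 / 4)
    (hlight : ∀ z ∈ N,
      |∑ i, ∑ j, (if |z i * z j| ≤ τ then (A i j - P i j) * (z i * z j) else 0)| ≤ T)
    (y : V → ℝ) :
    ∑ i, ∑ j, (A i j - P i j) * (y i * y j)
      ≤ 4 * (T + (3 * Δ / K + d * K) * (9 / 4) + ρ * (9 / 4) ^ 2 / τ) * ∑ i, y i ^ 2 := by
  refine (le_abs_self _).trans (abs_quadForm_le_of_net _ hN (fun z hz => ?_) y)
  have hA_heavy := sum_heavy_le hA hsymm hdiag hK hτ hd hΔ hdeg hsparse (hN2 z hz)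
  have hP_heavy : ∑ i, ∑ j, (if |z i * z j| ≤ τ then 0 else |P i j| * |z i * z j|)
      ≤ ρ * (9 / 4) ^ 2 / τ := by
    have h1 : ∀ i j, (if |z i * z j| ≤ τ then 0 else |P i j| * |z i * z j|)
        ≤ ρ / τ * (z i ^ 2 * z j ^ 2) := by
      intro i j
      split_ifs with h
      · positivity
      · rw [not_le] at h
        have h2 : |z i * z j| ≤ z i ^ 2 * z j ^ 2 / τ := by
          rw [le_div_iff₀ hτ, ← mul_pow, ← sq_abs, sq]
          exact mul_le_mul_of_nonneg_left h.le (abs_nonneg _)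
        calc _ ≤ ρ * (z i ^ 2 * z j ^ 2 / τ) := mul_le_mul (hP i j) h2 (abs_nonneg _) hρ
          _ = _ := by ring
    calc _ ≤ _ := Finset.sum_le_sum fun i _ => Finset.sum_le_sum fun j _ => h1 i j
      _ = ρ / τ * (∑ i, z i ^ 2) ^ 2 := by
        simp only [← Finset.mul_sum]
        rw [sq, Finset.sum_mul_sum]
        simp only [Finset.mul_sum]
      _ ≤ ρ / τ * (9 / 4) ^ 2 := by
        refine mul_le_mul_of_nonneg_left (pow_le_pow_left₀ ?_ (hN2 z hz) 2) (by positivity)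
        exact Finset.sum_nonneg fun i _ => sq_nonneg _
      _ = _ := by ring
  have hsplit : ∑ i, ∑ j, (A i j - P i j) * (z i * z j)
      = ∑ i, ∑ j, (if |z i * z j| ≤ τ then (A i j - P i j) * (z i * z j) else 0)
        + ∑ i, ∑ j, (if |z i * z j| ≤ τ then 0 else (A i j - P i j) * (z i * z j)) := by
    simp only [← Finset.sum_add_distrib]
    refine Finset.sum_congr rfl fun i _ => Finset.sum_congr rfl fun j _ => ?_
    split_ifs <;> ring
  have hheavy : |∑ i, ∑ j, (if |z i * z j| ≤ τ then 0 else (A i j - P i j) * (z i * z j))|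
      ≤ ∑ i, ∑ j, (if |z i * z j| ≤ τ then 0 else A i j * |z i * z j|)
        + ∑ i, ∑ j, (if |z i * z j| ≤ τ then 0 else |P i j| * |z i * z j|) := by
    simp only [← Finset.sum_add_distrib]
    refine (Finset.abs_sum_le_sum_abs _ _).trans (Finset.sum_le_sum fun i _ => ?_)
    refine (Finset.abs_sum_le_sum_abs _ _).trans (Finset.sum_le_sum fun j _ => ?_)
    split_ifs
    · simp
    · rw [abs_mul, ← add_mul]
      refine mul_le_mul_of_nonneg_right ?_ (abs_nonneg _)
      exact (abs_sub _ _).trans_eq (by rw [abs_of_nonneg (hA i j)])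
  rw [hsplit]
  refine (abs_add_le _ _).trans ?_
  linarith [hlight z hz]

/-! ### The random events -/

theorem meanAdj_nonneg {V : Type*} (g : V → ℝ) (p q : I) (i j : V) : 0 ≤ meanAdj g p q i j := by
  simp only [meanAdj, Matrix.of_apply]
  split_ifs
  · exact le_rfl
  · exact (edgeProb g p q _).2.1

theorem meanAdj_le {V : Type*}
    (g : V → ℝ) {p q : I} (hqp : q ≤ p) (i j : V) : meanAdj g p q i j ≤ p := by
  simp only [meanAdj, edgeProb, Matrix.of_apply, Sym2.lift_mk]
  split_ifs
  · exact p.2.1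
  · exact le_rfl
  · exact hqp

open Classical in
/-- Lower tail of the difference between the degrees of `i` inside and outside of its cluster. -/
theorem law_signedDegree_lt_le {V : Type*} [Fintype V]
    {g : V → ℝ} (hg : IsBalancedLabeling g) (p q : I) (i : V)
    {l : ℝ} (hl : 0 ≤ l) (a : ℝ) :
    (law g p q).real {G | ∑ j, g i * g j * G.adjMatrix ℝ i j < a}
      ≤ Real.exp (l * a + Fintype.card V / 2 *
          (p * (Real.exp (-l) - 1) + q * (Real.exp l - 1)) + p) := by
  have h := law_row_real_le_exp g p q i (fun j => -(l * (g i * g j))) (-(l * a))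
  refine le_trans (measureReal_mono fun G hG => ?_) (h.trans (Real.exp_le_exp.2 ?_))
  · simp only [Set.mem_ofPred_eq] at hG ⊢
    have h1 := mul_le_mul_of_nonneg_left hG.le hl
    rw [Finset.mul_sum] at h1
    rw [neg_le, ← Finset.sum_neg_distrib]
    refine le_trans (le_of_eq (Finset.sum_congr rfl fun j _ => by ring)) h1
  · have h1 : ∀ j, meanAdj g p q i j * (Real.exp (-(l * (g i * g j))) - 1)
        = (p * (Real.exp (-l) - 1) + q * (Real.exp l - 1)) / 2
          + (p * (Real.exp (-l) - 1) - q * (Real.exp l - 1)) / 2 * g i * g j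
          - if i = j then p * (Real.exp (-l) - 1) else 0 := by
      intro j
      rw [meanAdj_apply_eq hg.1]
      by_cases hij : i = j
      · subst hij
        rcases hg.1 i with h | h <;> simp [h] <;> ring
      · rcases hg.1 i with h | h <;> rcases hg.1 j with h' | h' <;> simp [h, h', hij] <;> ring
    simp only [h1, Finset.sum_add_distrib, Finset.sum_sub_distrib, ← Finset.mul_sum, hg.2,
      Finset.sum_ite_eq, Finset.mem_univ, if_true, Finset.sum_const, Finset.card_univ,
      nsmul_eq_mul]
    nlinarith [p.2.1, mul_nonneg p.2.1 (Real.exp_pos (-l)).le]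

open Classical in
theorem law_degree_gt_le {V : Type*} [Fintype V]
    (g : V → ℝ) {p q : I} (hqp : q ≤ p) (i : V) (a : ℝ) :
    (law g p q).real {G | a < ∑ j, G.adjMatrix ℝ i j}
      ≤ Real.exp (-a + 2 * (Fintype.card V * p)) := by
  have h := law_row_real_le_exp g p q i (fun _ => 1) a
  refine le_trans (measureReal_mono fun G hG => ?_) (h.trans (Real.exp_le_exp.2 ?_))
  · simp only [Set.mem_ofPred_eq, one_mul] at hG ⊢
    exact hG.le
  · have h1 : ∑ j, meanAdj g p q i j * (Real.exp 1 - 1) ≤ ∑ _j : V, (p : ℝ) * 2 :=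
      Finset.sum_le_sum fun j _ => mul_le_mul (meanAdj_le g hqp i j)
        (by linarith [Real.exp_one_lt_three]) (by linarith [Real.add_one_le_exp 1]) p.2.1
    rw [Finset.sum_const, Finset.card_univ, nsmul_eq_mul] at h1
    linarith

open Classical in
theorem law_sum_subset_gt_le {V : Type*} [Fintype V]
    (g : V → ℝ) {p q : I} (hqp : q ≤ p) (S : Finset V)
    {l : ℝ} (hl : 0 ≤ l) (a : ℝ) :
    (law g p q).real {G | a < ∑ i ∈ S, ∑ j ∈ S, G.adjMatrix ℝ i j}
      ≤ Real.exp (-(l * a) + (S.card : ℝ) ^ 2 * (p * Real.exp (2 * l)) / 2) := by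
  have h := law_real_le_exp g p q (fun i j => if i ∈ S then (if j ∈ S then l else 0) else 0)
    (fun i j => by split_ifs <;> rfl) (l * a)
  have hsum : ∀ f : V → V → ℝ, ∑ i, ∑ j, (if i ∈ S then (if j ∈ S then f i j else 0) else 0)
      = ∑ i ∈ S, ∑ j ∈ S, f i j := by
    intro f
    have h : ∀ i, (∑ j, if i ∈ S then (if j ∈ S then f i j else 0) else 0)
        = if i ∈ S then ∑ j ∈ S, f i j else 0 := by
      intro i
      split_ifs
      · rw [Finset.sum_ite_mem, Finset.univ_inter]
      · exact Finset.sum_const_zero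
    simp only [h, Finset.sum_ite_mem, Finset.univ_inter]
  refine le_trans (measureReal_mono fun G hG => ?_) (h.trans (Real.exp_le_exp.2 ?_))
  · simp only [Set.mem_ofPred_eq, ite_mul, zero_mul, hsum] at hG ⊢
    simp only [← Finset.mul_sum]
    exact mul_le_mul_of_nonneg_left hG.le hl
  · have h1 : ∀ i j, meanAdj g p q i j *
        (Real.exp (2 * (if i ∈ S then (if j ∈ S then l else 0) else 0)) - 1)
        ≤ if i ∈ S then (if j ∈ S then p * Real.exp (2 * l) else 0) else 0 := by
      intro i j
      split_ifs
      · exact mul_le_mul (meanAdj_le g hqp i j) (by linarith)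
          (by linarith [Real.add_one_le_exp (2 * l)]) p.2.1
      all_goals simp
    have h2 := Finset.sum_le_sum fun i (_ : i ∈ Finset.univ) =>
      Finset.sum_le_sum fun j (_ : j ∈ Finset.univ) => h1 i j
    rw [hsum fun _ _ => p * Real.exp (2 * l)] at h2
    simp only [Finset.sum_const, nsmul_eq_mul] at h2
    linarith

open Classical in
/-- Bernstein bound for a centred linear function of the adjacency matrix whose coefficients are
at most `1 / 2`. -/
theorem law_centered_gt_le {V : Type*} [Fintype V] (g : V → ℝ) (p q : I) (c : V → V → ℝ)
    (hc : ∀ i j, c i j = c j i) (hc1 : ∀ i j, |2 * c i j| ≤ 1) (t : ℝ) :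
    (law g p q).real {G | t < ∑ i, ∑ j, c i j * (G.adjMatrix ℝ i j - meanAdj g p q i j)}
      ≤ Real.exp (-t + 2 * ∑ i, ∑ j, meanAdj g p q i j * c i j ^ 2) := by
  have h := law_real_le_exp g p q c hc (t + ∑ i, ∑ j, c i j * meanAdj g p q i j)
  refine le_trans (measureReal_mono fun G hG => ?_) (h.trans (Real.exp_le_exp.2 ?_))
  · simp only [Set.mem_ofPred_eq, mul_sub, Finset.sum_sub_distrib] at hG ⊢
    linarith
  · have h1 : ∀ i j, meanAdj g p q i j * (Real.exp (2 * c i j) - 1)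
        ≤ 2 * (c i j * meanAdj g p q i j) + 4 * (meanAdj g p q i j * c i j ^ 2) := by
      intro i j
      have h2 := (abs_le.1 (Real.abs_exp_sub_one_sub_id_le (hc1 i j))).2
      calc _ ≤ meanAdj g p q i j * (2 * c i j + (2 * c i j) ^ 2) :=
            mul_le_mul_of_nonneg_left (by linarith) (meanAdj_nonneg g p q i j)
        _ = _ := by ring
    have h2 := Finset.sum_le_sum fun i (_ : i ∈ Finset.univ) =>
      Finset.sum_le_sum fun j (_ : j ∈ Finset.univ) => h1 i j
    simp only [Finset.sum_add_distrib, ← Finset.mul_sum] at h2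
    linarith

open Classical in
/-- The light pairs at a single vector `z`. -/
theorem law_light_gt_le {V : Type*} [Fintype V]
    (g : V → ℝ) {p q : I} (hqp : q ≤ p) {τ : ℝ} (hτ : 0 < τ) {z : V → ℝ}
    (hz : ∑ i, z i ^ 2 ≤ 9 / 4) (t : ℝ) :
    (law g p q).real {G | t < |∑ i, ∑ j, (if |z i * z j| ≤ τ then
        (G.adjMatrix ℝ i j - meanAdj g p q i j) * (z i * z j) else 0)|}
      ≤ 2 * Real.exp (-(t / (2 * τ)) + p * (9 / 4) ^ 2 / (2 * τ ^ 2)) := by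
  -- The exponential tilt `1 / (2 * τ)` is the largest for which `law_centered_gt_le` applies.
  have key : ∀ s : ℝ, |s| = 1 → (law g p q).real {G | t < s * ∑ i, ∑ j,
        (if |z i * z j| ≤ τ then (G.adjMatrix ℝ i j - meanAdj g p q i j) * (z i * z j) else 0)}
      ≤ Real.exp (-(t / (2 * τ)) + p * (9 / 4) ^ 2 / (2 * τ ^ 2)) := by
    intro s hs
    have hs2 : s ^ 2 = 1 := by rw [← sq_abs, hs, one_pow]
    have h := law_centered_gt_le g p q
      (fun i j => if |z i * z j| ≤ τ then s * (z i * z j) / (2 * τ) else 0)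
      (fun i j => by simp only [mul_comm (z i)]) (fun i j => ?_) (t / (2 * τ))
    · refine le_trans (measureReal_mono fun G hG => ?_) (h.trans (Real.exp_le_exp.2 ?_))
      · simp only [Set.mem_ofPred_eq] at hG ⊢
        refine (div_lt_div_of_pos_right hG (by positivity : 0 < 2 * τ)).trans_eq ?_
        simp only [Finset.mul_sum, Finset.sum_div]
        refine Finset.sum_congr rfl fun i _ => Finset.sum_congr rfl fun j _ => ?_
        split_ifs <;> ring
      · have h1 : ∀ i j, meanAdj g p q i j *
            (if |z i * z j| ≤ τ then s * (z i * z j) / (2 * τ) else 0) ^ 2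
            ≤ p / (4 * τ ^ 2) * (z i ^ 2 * z j ^ 2) := by
          intro i j
          have hp := p.2.1
          split_ifs
          · calc _ ≤ p * (s * (z i * z j) / (2 * τ)) ^ 2 :=
                  mul_le_mul_of_nonneg_right (meanAdj_le g hqp i j) (sq_nonneg _)
              _ = _ := by rw [div_pow, mul_pow, hs2]; ring
          · rw [zero_pow two_ne_zero, mul_zero]
            positivity
        have h2 := Finset.sum_le_sum fun i (_ : i ∈ Finset.univ) =>
          Finset.sum_le_sum fun j (_ : j ∈ Finset.univ) => h1 i j
        have h3 : ∑ i, ∑ j, (p : ℝ) / (4 * τ ^ 2) * (z i ^ 2 * z j ^ 2)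
            ≤ p / (4 * τ ^ 2) * (9 / 4) ^ 2 := by
          have hp := p.2.1
          calc _ = p / (4 * τ ^ 2) * (∑ i, z i ^ 2) ^ 2 := by
                simp only [← Finset.mul_sum]
                rw [sq (∑ i, z i ^ 2), Finset.sum_mul_sum]
                simp only [Finset.mul_sum]
            _ ≤ _ := mul_le_mul_of_nonneg_left
                (pow_le_pow_left₀ (Finset.sum_nonneg fun i _ => sq_nonneg _) hz 2) (by positivity)
        have h4 : (p : ℝ) * (9 / 4) ^ 2 / (2 * τ ^ 2) = 2 * (p / (4 * τ ^ 2) * (9 / 4) ^ 2) := by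
          field_simp
          ring
        rw [h4]
        linarith [h2.trans h3]
    · split_ifs with hl
      · rw [show 2 * (s * (z i * z j) / (2 * τ)) = s * ((z i * z j) / τ) by field_simp, abs_mul, hs,
          one_mul, abs_div, abs_of_pos hτ]
        exact (div_le_one hτ).2 hl
      · simp
  have h1 := key 1 (by simp)
  have h2 := key (-1) (by simp)
  simp only [one_mul, neg_one_mul] at h1 h2
  rw [two_mul]
  refine le_trans (measureReal_mono fun G hG => ?_)
    ((measureReal_union_le _ _).trans (add_le_add h1 h2))
  exact lt_abs.1 (show t < |_| from hG)

open Classical in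
/-- The deterministic core: recovery succeeds once the signed degrees exceed the spectral bound
of `quadForm_sub_le`. -/
theorem sdpSolutions_eq_of_degrees {V : Type*} [Fintype V]
    (G : SimpleGraph V) {g : V → ℝ} (hg : IsBalancedLabeling g)
    {p q : I} (hqp : q ≤ p) (hpq : (p : ℝ) + q ≤ 1) {a Δ d τ K T : ℝ} (hK : 0 < K) (hτ : 0 < τ)
    (hd : 0 ≤ d) (hΔ : 0 ≤ Δ)
    (ha : 4 * (T + (3 * Δ / K + d * K) * (9 / 4) + p * (9 / 4) ^ 2 / τ) < a)
    (hsigned : ∀ i, a ≤ ∑ j, g i * g j * G.adjMatrix ℝ i j)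
    (hdeg : ∀ i, ∑ j, G.adjMatrix ℝ i j ≤ Δ)
    (hsparse : ∀ S : Finset V, (S.card : ℝ) ≤ K * (9 / 4) / τ →
      ∑ i ∈ S, ∑ j ∈ S, G.adjMatrix ℝ i j ≤ d * S.card)
    {N : Finset (V → ℝ)}
    (hN : ∀ y : V → ℝ, ∑ i, y i ^ 2 ≤ 1 → ∃ z ∈ N, ∑ i, (y i - z i) ^ 2 ≤ 1 / 16)
    (hN2 : ∀ z ∈ N, ∑ i, z i ^ 2 ≤ 9 / 4)
    (hlight : ∀ z ∈ N, |∑ i, ∑ j, (if |z i * z j| ≤ τ then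
      (G.adjMatrix ℝ i j - meanAdj g p q i j) * (z i * z j) else 0)| ≤ T) :
    sdpSolutions G = {Matrix.vecMulVec g g} := by
  refine sdpSolutions_eq_singleton G hg.1 fun y hy hy0 => ?_
  refine lt_of_lt_of_le ?_ (certForm_signedAdj_ge G hg hpq hy)
  have h1 := quadForm_sub_le (A := G.adjMatrix ℝ) (P := meanAdj g p q) (ρ := p)
    (fun i j => by rw [SimpleGraph.adjMatrix_apply]; split_ifs <;> simp)
    (fun i j => by simp only [SimpleGraph.adjMatrix_apply, G.adj_comm])
    (fun i => by simp) hK hτ hd hΔ p.2.1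
    (fun i j => by rw [abs_of_nonneg (meanAdj_nonneg g p q i j)]; exact meanAdj_le g hqp i j)
    hdeg hsparse hN hN2 hlight y
  have h2 : a * ∑ i, y i ^ 2 ≤ ∑ i, (∑ j, g i * g j * G.adjMatrix ℝ i j) * y i ^ 2 := by
    rw [Finset.mul_sum]
    exact Finset.sum_le_sum fun i _ => mul_le_mul_of_nonneg_right (hsigned i) (sq_nonneg _)
  have h3 : 0 < ∑ i, y i ^ 2 := by
    obtain ⟨i, hi⟩ := Function.ne_iff.1 hy0
    exact Finset.sum_pos' (fun i _ => sq_nonneg _) ⟨i, Finset.mem_univ i, by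
      have : y i ≠ 0 := hi
      positivity⟩
  have h4 := mul_lt_mul_of_pos_right ha h3
  linarith

open Classical in
/-- Union bound over the events of `sdpSolutions_eq_of_degrees`. The parameters `l` and `μ` are
exponential tilts. -/
theorem law_not_recovered_le {V : Type*} [Fintype V] {g : V → ℝ} (hg : IsBalancedLabeling g)
    {p q : I} (hqp : q ≤ p) (hpq : (p : ℝ) + q ≤ 1) {a Δ d τ K T l μ : ℝ} (hK : 0 < K)
    (hτ : 0 < τ) (hd : 0 ≤ d) (hΔ : 0 ≤ Δ) (hl : 0 ≤ l) (hμ : 0 ≤ μ)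
    (ha : 4 * (T + (3 * Δ / K + d * K) * (9 / 4) + p * (9 / 4) ^ 2 / τ) < a) :
    (law g p q).real {G | sdpSolutions G = {Matrix.vecMulVec g g}}ᶜ
      ≤ Fintype.card V * Real.exp (l * a + Fintype.card V / 2 *
            (p * (Real.exp (-l) - 1) + q * (Real.exp l - 1)) + p)
        + Fintype.card V * Real.exp (-Δ + 2 * (Fintype.card V * p))
        + ((1 + Real.exp (-(μ * d) + K * (9 / 4) / τ * (p * Real.exp (2 * μ)) / 2))
            ^ Fintype.card V - 1)
        + 25 ^ Fintype.card V *
            (2 * Real.exp (-(T / (2 * τ)) + p * (9 / 4) ^ 2 / (2 * τ ^ 2))) := by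
  obtain ⟨N, hNcard, hN2, hN⟩ := exists_net V
  set x := Real.exp (-(μ * d) + K * (9 / 4) / τ * (p * Real.exp (2 * μ)) / 2) with hx
  let B₁ : Set (SimpleGraph V) := ⋃ i ∈ (Finset.univ : Finset V),
    {G | ∑ j, g i * g j * G.adjMatrix ℝ i j < a}
  let B₂ : Set (SimpleGraph V) := ⋃ i ∈ (Finset.univ : Finset V),
    {G | Δ < ∑ j, G.adjMatrix ℝ i j}
  let 𝒮 : Finset (Finset V) := Finset.univ.filter fun S =>
    S ≠ ∅ ∧ (S.card : ℝ) ≤ K * (9 / 4) / τ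
  let B₃ : Set (SimpleGraph V) := ⋃ S ∈ 𝒮,
    {G | d * S.card < ∑ i ∈ S, ∑ j ∈ S, G.adjMatrix ℝ i j}
  let B₄ : Set (SimpleGraph V) := ⋃ z ∈ N, {G | T < |∑ i, ∑ j, (if |z i * z j| ≤ τ then
      (G.adjMatrix ℝ i j - meanAdj g p q i j) * (z i * z j) else 0)|}
  have hsub : {G : SimpleGraph V | sdpSolutions G = {Matrix.vecMulVec g g}}ᶜ
      ⊆ B₁ ∪ B₂ ∪ B₃ ∪ B₄ := by
    intro G hG
    by_contra hcon
    simp only [B₁, B₂, B₃, B₄, Set.mem_union, Set.mem_iUnion, not_or, not_exists,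
      Set.mem_ofPred_eq, not_lt, Finset.mem_univ, forall_true_left] at hcon
    obtain ⟨⟨⟨h1, h2⟩, h3⟩, h4⟩ := hcon
    refine hG (sdpSolutions_eq_of_degrees G hg hqp hpq hK hτ hd hΔ ha h1 h2 (fun S hS => ?_)
      hN hN2 h4)
    rcases S.eq_empty_or_nonempty with rfl | hne
    · simp
    · exact h3 S (Finset.mem_filter.2 ⟨Finset.mem_univ _, hne.ne_empty, hS⟩)
  have hB₁ := (measureReal_biUnion_finset_le (μ := law g p q) Finset.univ _).trans
    (Finset.sum_le_sum fun i _ => law_signedDegree_lt_le hg p q i hl a)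
  have hB₂ := (measureReal_biUnion_finset_le (μ := law g p q) Finset.univ _).trans
    (Finset.sum_le_sum fun i _ => law_degree_gt_le g hqp i Δ)
  have hB₄ := (measureReal_biUnion_finset_le (μ := law g p q) N _).trans
    (Finset.sum_le_sum fun z hz => law_light_gt_le g hqp hτ (hN2 z hz) T)
  have hB₃ : (law g p q).real B₃ ≤ (1 + x) ^ Fintype.card V - 1 := by
    have h1 : ∀ S ∈ 𝒮, (law g p q).real {G | d * S.card < ∑ i ∈ S, ∑ j ∈ S, G.adjMatrix ℝ i j}
        ≤ x ^ S.card := by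
      intro S hS
      have hS := (Finset.mem_filter.1 hS).2.2
      refine (law_sum_subset_gt_le g hqp S hμ _).trans ?_
      rw [hx, ← Real.exp_nat_mul, Real.exp_le_exp]
      have hpe : 0 ≤ (p : ℝ) * Real.exp (2 * μ) := mul_nonneg p.2.1 (Real.exp_pos _).le
      have h2 := mul_le_mul_of_nonneg_right (mul_le_mul_of_nonneg_left hS
        (Nat.cast_nonneg (α := ℝ) S.card)) hpe
      linarith
    refine (measureReal_biUnion_finset_le (μ := law g p q) 𝒮 _).trans
      ((Finset.sum_le_sum h1).trans ?_)
    have h2 : ∑ S : Finset V, x ^ S.card = (1 + x) ^ Fintype.card V := by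
      rw [add_comm, ← Finset.card_univ, ← Finset.powerset_univ]
      have := Finset.sum_pow_mul_eq_add_pow x 1 (Finset.univ : Finset V)
      simpa using this
    rw [← h2, ← Finset.sum_erase_add _ _ (Finset.mem_univ (∅ : Finset V)), Finset.card_empty,
      pow_zero, add_sub_cancel_right]
    refine Finset.sum_le_sum_of_subset_of_nonneg (fun S hS => ?_)
      fun S _ _ => pow_nonneg (Real.exp_pos _).le _
    exact Finset.mem_erase.2 ⟨(Finset.mem_filter.1 hS).2.1, Finset.mem_univ _⟩
  rw [Finset.sum_const, nsmul_eq_mul] at hB₁ hB₂ hB₄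
  rw [Finset.card_univ] at hB₁ hB₂
  refine (measureReal_mono hsub).trans ((measureReal_union_le _ _).trans (add_le_add
    ((measureReal_union_le _ _).trans (add_le_add ((measureReal_union_le _ _).trans
      (add_le_add hB₁ hB₂)) hB₃)) (hB₄.trans ?_)))
  refine mul_le_mul_of_nonneg_right ?_ (by positivity)
  exact_mod_cast hNcard

/-! ### Choice of the constants -/

/-- The recovery threshold in the form in which it enters the Chernoff bound for the signed
degrees. The optimal value of
`exp l` is `√(α / β)`; for `β = 0`, where this is infinite, a large value is taken instead. -/
theorem exists_tilt {α β : ℝ} (hβ : 0 ≤ β) (hβα : β < α)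
    (hαβ : Real.sqrt α - Real.sqrt β > Real.sqrt 2) :
    ∃ l : ℝ, 0 < l ∧ (α * (Real.exp (-l) - 1) + β * (Real.exp l - 1)) / 2 < -1 := by
  have hα : 0 < α := hβ.trans_lt hβα
  rcases hβ.eq_or_lt with rfl | hβ0
  · have hα2 : 2 < α := by
      rw [Real.sqrt_zero, sub_zero] at hαβ
      exact (Real.sqrt_lt_sqrt_iff zero_le_two).1 hαβ
    have h2 : 0 < α - 2 := by linarith
    refine ⟨Real.log (2 * α / (α - 2)), Real.log_pos ?_, ?_⟩
    · rw [one_lt_div h2]; linarith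
    · rw [Real.exp_neg, Real.exp_log (by positivity), inv_div]
      have : α * ((α - 2) / (2 * α) - 1) = -(α + 2) / 2 := by field_simp; ring
      rw [this]
      linarith
  · have ha := Real.sqrt_pos.2 hα
    have hb := Real.sqrt_pos.2 hβ0
    have hlt := Real.sqrt_lt_sqrt hβ hβα
    refine ⟨Real.log (Real.sqrt α / Real.sqrt β), Real.log_pos ((one_lt_div hb).2 hlt), ?_⟩
    rw [Real.exp_neg, Real.exp_log (by positivity), inv_div]
    have h1 : α * (Real.sqrt β / Real.sqrt α - 1) + β * (Real.sqrt α / Real.sqrt β - 1)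
        = -(Real.sqrt α - Real.sqrt β) ^ 2 := by
      have hα' := Real.sq_sqrt hα.le
      have hβ' := Real.sq_sqrt hβ
      generalize Real.sqrt α = A at *
      generalize Real.sqrt β = B at *
      rw [← hα', ← hβ']
      field_simp
      ring
    rw [h1]
    have h2 := Real.sq_sqrt (zero_le_two (α := ℝ))
    nlinarith [Real.sqrt_nonneg 2]

theorem one_add_pow_sub_one_le {k : ℕ} {n L x : ℝ} (hk : k = n) (hn : n = Real.exp L)
    (hL : 0 ≤ L) (hx0 : 0 ≤ x) (hx : x ≤ Real.exp (-(3 * L))) :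
    (1 + x) ^ k - 1 ≤ 2 * Real.exp (-L) := by
  have h4 : n * Real.exp (-(3 * L)) = Real.exp (-(2 * L)) := by
    rw [hn, ← Real.exp_add]; congr 1; ring
  have h5 : Real.exp (-(2 * L)) ≤ Real.exp (-L) := Real.exp_le_exp.2 (by linarith)
  have h6 : Real.exp (-(2 * L)) ≤ 1 := Real.exp_le_one_iff.2 (by linarith)
  have h7 := (abs_le.1 (Real.abs_exp_sub_one_sub_id_le
    (x := Real.exp (-(2 * L))) (by rwa [abs_of_pos (Real.exp_pos _)]))).2
  calc _ ≤ (Real.exp (Real.exp (-(3 * L)))) ^ k - 1 := by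
        gcongr
        linarith [Real.add_one_le_exp (Real.exp (-(3 * L)))]
    _ = Real.exp (Real.exp (-(2 * L))) - 1 := by rw [← Real.exp_nat_mul, hk, h4]
    _ ≤ 2 * Real.exp (-(2 * L)) := by nlinarith [Real.exp_pos (-(2 * L))]
    _ ≤ _ := by linarith

theorem pow_mul_exp_le {k : ℕ} {n L x : ℝ} (hk : k = n) (hx : x ≤ n) (hL : L ≤ n) :
    25 ^ k * (2 * Real.exp (-(6 * n) + x)) ≤ 2 * Real.exp (-L) := by
  have h4 : (25 : ℝ) ≤ Real.exp 4 := by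
    have h := pow_le_pow_left₀ (by norm_num) Real.exp_one_gt_d9.le 4
    rw [← Real.exp_nat_mul] at h
    norm_num at h
    linarith
  have h5 : (25 : ℝ) ^ k ≤ Real.exp (4 * n) := by
    calc _ ≤ (Real.exp 4) ^ k := pow_le_pow_left₀ (by norm_num) h4 _
      _ = _ := by rw [← Real.exp_nat_mul, hk, mul_comm]
  calc _ ≤ Real.exp (4 * n) * (2 * Real.exp (-(5 * n))) := by
        refine mul_le_mul h5 ?_ (by positivity) (Real.exp_pos _).le
        exact mul_le_mul_of_nonneg_left (Real.exp_le_exp.2 (by linarith)) zero_le_two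
    _ = 2 * Real.exp (-n) := by
        rw [mul_left_comm, ← Real.exp_add]; congr 2; ring
    _ ≤ _ := mul_le_mul_of_nonneg_left (Real.exp_le_exp.2 (by linarith)) zero_le_two

/-- Exact recovery on an arbitrary vertex set of size `n`, for all `n` with `log n` above a
constant. The size enters as a real number. -/
theorem exists_recovery_bound {α β : ℝ} (hβ : 0 ≤ β) (hβα : β < α)
    (hαβ : Real.sqrt α - Real.sqrt β > Real.sqrt 2) :
    ∃ c : ℝ, 0 < c ∧ ∃ L₀ : ℝ, ∀ (V : Type) [Fintype V] (n : ℝ), Fintype.card V = n → 0 < n →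
      L₀ ≤ Real.log n → (α + β) * Real.log n ≤ n →
      ∀ p q : I, (p : ℝ) = α * Real.log n / n → (q : ℝ) = β * Real.log n / n →
      ∀ g : V → ℝ, IsBalancedLabeling g →
        1 - n ^ (-c) ≤ (law g p q).real {G | sdpSolutions G = {Matrix.vecMulVec g g}} := by
  have hα : 0 < α := hβ.trans_lt hβα
  obtain ⟨l, hl, htilt⟩ := exists_tilt hβ hβα hαβ
  obtain ⟨κ, hκ⟩ : ∃ x, x = (-1 - (α * (Real.exp (-l) - 1) + β * (Real.exp l - 1)) / 2) / 3 :=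
    ⟨_, rfl⟩
  have hκ0 : 0 < κ := by rw [hκ]; linarith
  -- The signed degrees are at least `ε * log n`. `K` and `η` make the two contributions of the
  -- heavy pairs of `A` to the spectral bound equal to `(ε / 4) * log n`, and `δ` makes the tail of
  -- the light pairs at deviation `(ε / 16) * log n` small enough to beat the size of the net.
  obtain ⟨ε, hε⟩ : ∃ x, x = κ / l := ⟨_, rfl⟩
  have hε0 : 0 < ε := by rw [hε]; positivity
  obtain ⟨Δ, hΔ⟩ : ∃ x, x = 2 * α + 2 := ⟨_, rfl⟩
  have hΔ0 : 0 < Δ := by rw [hΔ]; positivity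
  obtain ⟨K, hK⟩ : ∃ x, x = 108 * Δ / ε := ⟨_, rfl⟩
  have hK0 : 0 < K := by rw [hK]; positivity
  obtain ⟨η, hη⟩ : ∃ x, x = ε / (36 * K) := ⟨_, rfl⟩
  have hη0 : 0 < η := by rw [hη]; positivity
  obtain ⟨δ, hδ⟩ : ∃ x, x = ε / 192 := ⟨_, rfl⟩
  have hδ0 : 0 < δ := by rw [hδ]; positivity
  obtain ⟨μ, hμ⟩ : ∃ x, x = 4 / η := ⟨_, rfl⟩
  have hμ0 : 0 < μ := by rw [hμ]; positivity
  obtain ⟨c, hc⟩ : ∃ x, x = min κ (1 / 2) := ⟨_, rfl⟩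
  have hc0 : 0 < c := by rw [hc]; positivity
  refine ⟨c, hc0, 1 + 8 / c + 82 * (α / δ) / ε + K * (9 / 4) * (α / δ) * Real.exp (2 * μ) / 2
    + (9 / 4) ^ 2 * α / (2 * δ ^ 2), ?_⟩
  intro V _ n hn hn0 hL₀ hαn p q hp hq g hg
  set L := Real.log n with hL
  have hnL : n = Real.exp L := (Real.exp_log hn0).symm
  clear_value L
  have t1 : 0 < 8 / c := by positivity
  have t2 : 0 < 82 * (α / δ) / ε := by positivity
  have t3 : 0 < K * (9 / 4) * (α / δ) * Real.exp (2 * μ) / 2 := by positivity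
  have t4 : 0 < (9 / 4) ^ 2 * α / (2 * δ ^ 2) := by positivity
  have hL1 : 1 ≤ L := by linarith
  have hL0 : 0 < L := by linarith
  have hLc : 8 ≤ c * L := by
    have h : 8 / c ≤ L := by linarith
    rw [div_le_iff₀ hc0] at h
    linarith
  have hLε : 82 * (α / δ) ≤ ε * L := by
    have h : 82 * (α / δ) / ε ≤ L := by linarith
    rw [div_le_iff₀ hε0] at h
    linarith
  have hL3 : K * (9 / 4) * (α / δ) * Real.exp (2 * μ) / 2 ≤ L := by linarith
  have hL4 : (9 / 4) ^ 2 * α / (2 * δ ^ 2) ≤ L := by linarith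
  have hqp : q ≤ p := by
    rw [← Subtype.coe_le_coe, hp, hq]
    gcongr
  have hpq : (p : ℝ) + q ≤ 1 := by
    rw [hp, hq, ← add_div, ← add_mul]
    exact (div_le_one hn0).2 hαn
  have hnp : n * p = α * L := by rw [hp]; field_simp
  have hnq : n * q = β * L := by rw [hq]; field_simp
  obtain ⟨τ, hτ⟩ : ∃ x, x = δ * L / n := ⟨_, rfl⟩
  have hτ0 : 0 < τ := by rw [hτ]; positivity
  have hpτ : (p : ℝ) / τ = α / δ := by rw [hp, hτ]; field_simp
  have ha : 4 * (ε / 16 * L + (3 * (Δ * L) / K + η * L * K) * (9 / 4) + p * (9 / 4) ^ 2 / τ)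
      < ε * L := by
    have h1 : 3 * (Δ * L) / K = ε * L / 36 := by rw [hK]; field_simp; norm_num
    have h2 : η * L * K = ε * L / 36 := by rw [hη]; field_simp
    have h3 : (p : ℝ) * (9 / 4) ^ 2 / τ = (9 / 4) ^ 2 * (α / δ) := by rw [← hpτ]; ring
    rw [h1, h2, h3]
    have : 0 < ε * L := by positivity
    linarith
  have hbound := law_not_recovered_le hg hqp hpq (a := ε * L) (Δ := Δ * L) (d := η * L) hK0 hτ0
    (by positivity) (by positivity) hl.le hμ0.le ha
  rw [hn] at hbound
  have hexp1 : Real.exp (-L) ≤ Real.exp (-(2 * c * L)) := by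
    have : c ≤ 1 / 2 := hc ▸ min_le_right _ _
    exact Real.exp_le_exp.2 (by linarith only [mul_le_mul_of_nonneg_right this hL0.le])
  have b1 : n * Real.exp (l * (ε * L) + n / 2 *
      (p * (Real.exp (-l) - 1) + q * (Real.exp l - 1)) + p) ≤ 3 * Real.exp (-(2 * c * L)) := by
    have h1 : l * (ε * L) = κ * L := by rw [hε]; field_simp
    have h2 : n / 2 * (p * (Real.exp (-l) - 1) + q * (Real.exp l - 1)) = -(1 + 3 * κ) * L := by
      calc _ = (n * p * (Real.exp (-l) - 1) + n * q * (Real.exp l - 1)) / 2 := by ring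
        _ = _ := by rw [hnp, hnq, hκ]; ring
    have hp1 : (p : ℝ) ≤ 1 := p.2.2
    have hcκ : c ≤ κ := hc ▸ min_le_left _ _
    rw [h1, h2]
    calc _ ≤ Real.exp L * Real.exp (κ * L + -(1 + 3 * κ) * L + 1) := by
          rw [← hnL]
          exact mul_le_mul_of_nonneg_left (Real.exp_le_exp.2 (by linarith)) hn0.le
      _ = Real.exp 1 * Real.exp (-(2 * κ * L)) := by
          rw [← Real.exp_add, ← Real.exp_add]; congr 1; ring
      _ ≤ 3 * Real.exp (-(2 * c * L)) := by
          refine mul_le_mul Real.exp_one_lt_three.le (Real.exp_le_exp.2 ?_) (Real.exp_pos _).le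
            (by norm_num)
          linarith only [mul_le_mul_of_nonneg_right hcκ hL0.le]
  have b2 : n * Real.exp (-(Δ * L) + 2 * (n * p)) ≤ Real.exp (-L) := by
    rw [hnp]
    conv_lhs => rw [hnL]
    rw [← Real.exp_add]
    exact Real.exp_le_exp.2 (by rw [hΔ]; linarith)
  have b3 : (1 + Real.exp (-(μ * (η * L)) + K * (9 / 4) / τ * (p * Real.exp (2 * μ)) / 2))
      ^ Fintype.card V - 1 ≤ 2 * Real.exp (-L) := by
    have h1 : μ * (η * L) = 4 * L := by rw [hμ]; field_simp
    have h2 : K * (9 / 4) / τ * (p * Real.exp (2 * μ)) / 2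
        = K * (9 / 4) * (α / δ) * Real.exp (2 * μ) / 2 := by rw [← hpτ]; ring
    rw [h1, h2]
    exact one_add_pow_sub_one_le hn hnL hL0.le (Real.exp_pos _).le
      (Real.exp_le_exp.2 (by linarith only [hL3]))
  have b4 : 25 ^ Fintype.card V * (2 * Real.exp (-(ε / 16 * L / (2 * τ))
      + p * (9 / 4) ^ 2 / (2 * τ ^ 2))) ≤ 2 * Real.exp (-L) := by
    have h1 : ε / 16 * L / (2 * τ) = 6 * n := by
      rw [hτ, show ε = 192 * δ by rw [hδ]; ring]
      field_simp
      norm_num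
    have h2 : (p : ℝ) * (9 / 4) ^ 2 / (2 * τ ^ 2) = (9 / 4) ^ 2 * α / (2 * δ ^ 2) * (n / L) := by
      rw [hp, hτ]; field_simp
    have h3 : (9 / 4) ^ 2 * α / (2 * δ ^ 2) * (n / L) ≤ n := by
      calc _ ≤ L * (n / L) := mul_le_mul_of_nonneg_right hL4 (by positivity)
        _ = n := by field_simp
    have hLn : L ≤ n := by linarith only [Real.log_le_sub_one_of_pos hn0, hL]
    rw [h1, h2]
    exact pow_mul_exp_le hn h3 hLn
  have hfinal : 8 * Real.exp (-(2 * c * L)) ≤ n ^ (-c) := by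
    rw [Real.rpow_def_of_pos hn0, ← hL]
    have h1 : Real.exp (L * -c) = Real.exp (c * L) * Real.exp (-(2 * c * L)) := by
      rw [← Real.exp_add]; congr 1; ring
    rw [h1]
    refine mul_le_mul_of_nonneg_right ?_ (Real.exp_pos _).le
    linarith [Real.add_one_le_exp (c * L)]
  rw [probReal_compl_eq_one_sub (MeasurableSet.of_discrete)] at hbound
  linarith

end SBM

theorem mainTheorem3 (α β : ℝ) (hβ : 0 ≤ β) (hβα : β < α)
    (hαβ : Real.sqrt α - Real.sqrt β > Real.sqrt 2) :
    ∃ c : ℝ, 0 < c ∧ ∀ᶠ n : ℕ in atTop, Even n →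
      ∀ p q : I, (p : ℝ) = α * Real.log n / n → (q : ℝ) = β * Real.log n / n →
      ∀ g : Fin n → ℝ, SBM.IsBalancedLabeling g →
        1 - (n : ℝ) ^ (-c) ≤
          (SBM.law g p q).real
            {G : SimpleGraph (Fin n) | SBM.sdpSolutions G = {Matrix.vecMulVec g g}} := by
  obtain ⟨c, hc, L₀, h⟩ := SBM.exists_recovery_bound hβ hβα hαβ
  refine ⟨c, hc, ?_⟩
  have hlog : ∀ᶠ n : ℕ in atTop, L₀ ≤ Real.log n :=
    (Real.tendsto_log_atTop.comp tendsto_natCast_atTop_atTop).eventually_ge_atTop L₀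
  have hαβ0 : 0 < α + β := by linarith
  have hlin : ∀ᶠ n : ℕ in atTop, ‖Real.log n‖ ≤ (α + β)⁻¹ * ‖(n : ℝ)‖ :=
    tendsto_natCast_atTop_atTop.eventually
      (Real.isLittleO_log_id_atTop.def (inv_pos.2 hαβ0))
  filter_upwards [hlog, hlin, eventually_gt_atTop 0] with n h1 h2 h3 _ p q hp hq g hg
  refine h (Fin n) n (by simp) (by exact_mod_cast h3) h1 ?_ p q hp hq g hg
  rw [Real.norm_natCast, ← div_eq_inv_mul, le_div_iff₀ hαβ0, mul_comm] at h2
  exact (mul_le_mul_of_nonneg_left (Real.le_norm_self _) hαβ0.le).trans h2
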